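/- Let $\mathcal H$ be a separable reproducing kernel Hilbert space of real functions on a measurable space $\mathcal X$, with jointly measurable kernel $K$ satisfying $\sup_x K(x,x)<\infty$, and write $K_x=K(x,\cdot)$. Let $\rho_X$ be a probability measure on $\mathcal X$, let $\iota:\mathcal H\to L^2(\mathcal X,\rho_X)$ be the inclusion and $B=\iota^*\iota$. For $n\ge 1$ and points $\mathbf x=(x_1,\dots,x_n)\in\mathcal X^n$, let $\iota_{\mathbf x}:\mathcal H\to\mathbb R^n$, $(\iota_{\mathbf x} f)_i=f(x_i)$, where $\mathbb R^n$ carries the inner product $\langle u,v\rangle=n^{-1}\sum_i u_iv_i$, and let $B_{\mathbf x}=\iota_{\mathbf x}^*\iota_{\mathbf x}$, that is, $B_{\mathbf x}f=n^{-1}\sum_{i=1}^n f(x_i)K_{x_i}$. Fix $\lambda>0$ and put $S=\lambda^{-1}B$, $S_{\mathbf x}=\lambda^{-1}B_{\mathbf x}$. Functions of self-adjoint operators are understood through the functional calculus. Then $$\Psi_{\mathbf x}:=\bigl\|(I+S)^{-1/2}(S-S_{\mathbf x})\bigr\|_{\mathrm{HS}}$$ is finite, and the following hold, $\|\cdot\|$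 being the operator norm. 1. Let $\varphi:[0,\infty)\to[0,\infty)$ be nondecreasing, not identically zero, and sublinear in the sense that $t\mapsto\varphi(t)/t$ is nonincreasing on $(0,\infty)$. Then $\varphi(I+S_{\mathbf x})$ is invertible and $$\bigl\|\varphi(I+S)\,\varphi(I+S_{\mathbf x})^{-1}\bigr\|\le(\Psi_{\mathbf x}+1)^2 .$$ 2. For every $r\in[0,1]$, $$\bigl\|(I+S)^r(I+S_{\mathbf x})^{-r}\bigr\|\le(\Psi_{\mathbf x}+1)^{2r}.$$ -/

import Mathlib

namespace RealFunctionalCalculus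

open Polynomial

variable {H : Type*} [NormedAddCommGroup H] [InnerProductSpace ℝ H] [CompleteSpace H]

theorem isSelfAdjoint_aeval {T : H →L[ℝ] H} (hT : IsSelfAdjoint T) (p : ℝ[X]) :
    IsSelfAdjoint (aeval T p) := by
  induction p using Polynomial.induction_on with
  | C a =>
    rw [aeval_C, Algebra.algebraMap_eq_smul_one]
    exact (IsSelfAdjoint.all a).smul (IsSelfAdjoint.one _)
  | add p q hp hq => rw [map_add]; exact hp.add hq
  | monomial n a _ =>
    rw [map_mul, aeval_C, map_pow, aeval_X, Algebra.algebraMap_eq_smul_one, smul_one_mul]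
    exact (IsSelfAdjoint.all a).smul (hT.pow _)

theorem isUnit_aeval {T : H →L[ℝ] H} (hT : IsSelfAdjoint T) (q : ℝ[X]) (hq0 : q ≠ 0)
    (hq : ∀ t ∈ spectrum ℝ T, q.eval t ≠ 0) : IsUnit (aeval T q) := by
  induction q using WfDvdMonoid.induction_on_irreducible with
  | zero => exact absurd rfl hq0
  | unit u hu => exact hu.map _
  | mul a f ha hf ih =>
    rw [map_mul]
    refine IsUnit.mul ?_ (ih ha fun t ht h0 => hq t ht (by rw [eval_mul, h0, mul_zero]))
    have hfev : ∀ t ∈ spectrum ℝ T, f.eval t ≠ 0 := fun t ht h0 =>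
      hq t ht (by rw [eval_mul, h0, zero_mul])
    have hdeg : f.degree ≤ 2 := hf.degree_le_two
    by_cases hroot : ∃ t, f.eval t = 0
    · obtain ⟨t, ht⟩ := hroot
      have htn : t ∉ spectrum ℝ T := fun h => hfev t h ht
      obtain ⟨g, hg⟩ := dvd_iff_isRoot.mpr ht
      have hgu : IsUnit g := (hf.isUnit_or_isUnit hg).resolve_left (not_isUnit_X_sub_C t)
      rw [hg, map_mul]
      refine IsUnit.mul ?_ (hgu.map _)
      rw [spectrum.notMem_iff] at htn
      rw [map_sub, aeval_X, aeval_C]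
      rw [← neg_sub]
      exact htn.neg
    · push Not at hroot
      set a2 := f.coeff 2
      set a1 := f.coeff 1
      set a0 := f.coeff 0
      have hfe : f = C a2 * X ^ 2 + C a1 * X + C a0 :=
        eq_quadratic_of_degree_le_two hdeg
      have hev : ∀ t, f.eval t = a2 * t ^ 2 + a1 * t + a0 := fun t => by
        rw [hfe]; simp
      have ha2 : a2 ≠ 0 := by
        intro h2
        by_cases h1 : a1 = 0
        · have : f = C a0 := by rw [hfe, h2, h1]; simp
          have h0 : a0 ≠ 0 := fun h => hf.ne_zero (by rw [this, h, C_0])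
          exact hf.not_isUnit (this ▸ isUnit_C.mpr (isUnit_iff_ne_zero.mpr h0))
        · exact hroot (-a0 / a1) (by rw [hev, h2]; field_simp; ring)
      set b := a1 / (2 * a2) with hb
      set c := a0 / a2 - b ^ 2 with hc
      have hcpos : 0 < c := by
        by_contra hneg
        push Not at hneg
        refine hroot (-b + Real.sqrt (-c)) ?_
        have hs : Real.sqrt (-c) ^ 2 = -c := Real.sq_sqrt (by linarith)
        have h1 : a1 = 2 * a2 * b := by rw [hb]; field_simp
        have h0 : a0 = a2 * (c + b ^ 2) := by rw [hc]; field_simp; ring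
        rw [hev, h1, h0]
        linear_combination a2 * hs
      have hfe2 : f = C a2 * ((X + C b) ^ 2 + C c) := by
        have h1 : a1 = 2 * a2 * b := by rw [hb]; field_simp
        have h0 : a0 = a2 * (c + b ^ 2) := by rw [hc]; field_simp; ring
        rw [hfe, h1, h0]
        simp only [C_mul, C_add, C_pow, C_ofNat]
        ring
      rw [hfe2, map_mul]
      refine IsUnit.mul ((isUnit_C.mpr (isUnit_iff_ne_zero.mpr ha2)).map _) ?_
      have hSA : IsSelfAdjoint (aeval T (X + C b)) := isSelfAdjoint_aeval hT _
      rw [map_add, map_pow, aeval_C]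
      set S := aeval T (X + C b)
      refine ContinuousLinearMap.isUnit_of_forall_le_norm_inner_map _
        (c := ⟨c, hcpos.le⟩) (by exact_mod_cast hcpos) fun x => ?_
      have key : inner ℝ ((S ^ 2 + algebraMap ℝ (H →L[ℝ] H) c) x) x = ‖S x‖ ^ 2 + c * ‖x‖ ^ 2 := by
        have h1 : inner ℝ (S (S x)) x = ‖S x‖ ^ 2 := by
          rw [← real_inner_self_eq_norm_sq]
          exact hSA.isSymmetric (S x) x
        rw [add_apply, inner_add_left, Algebra.algebraMap_eq_smul_one,
          smul_apply, inner_smul_left, pow_two S]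
        change inner ℝ (S (S x)) x + c * inner ℝ x x = _
        rw [h1, real_inner_self_eq_norm_sq]
      rw [key, Real.norm_of_nonneg (by positivity)]
      change ‖x‖ ^ 2 * c ≤ _
      nlinarith [sq_nonneg ‖S x‖]

theorem spectrum_nonempty [Nontrivial H] {T : H →L[ℝ] H} (hT : IsSelfAdjoint T) :
    (spectrum ℝ T).Nonempty := by
  by_contra hemp
  rw [Set.not_nonempty_iff_eq_empty] at hemp
  have h := ContinuousLinearMap.spectralRadius_eq_nnnorm T hT
  rw [spectralRadius, hemp] at h
  simp at h
  rw [nnnorm_eq_zero.mp h.symm] at hemp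
  simp [spectrum.zero_eq] at hemp

theorem spectrum_aeval {T : H →L[ℝ] H} (hT : IsSelfAdjoint T) (p : ℝ[X]) :
    spectrum ℝ (aeval T p) ⊆ (fun t => p.eval t) '' spectrum ℝ T := by
  intro r hr
  by_contra hcon
  have h : ∀ t ∈ spectrum ℝ T, (C r - p).eval t ≠ 0 := fun t ht h0 =>
    hcon ⟨t, ht, by simp only [eval_sub, eval_C] at h0; linarith⟩
  by_cases h0 : C r - p = 0
  · rw [← sub_eq_zero.mp h0] at hr hcon
    rw [aeval_C] at hr
    rcases subsingleton_or_nontrivial H with hH | hH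
    · have : IsUnit (algebraMap ℝ (H →L[ℝ] H) r - algebraMap ℝ (H →L[ℝ] H) r) :=
        isUnit_of_subsingleton _
      exact spectrum.mem_iff.mp hr this
    · obtain ⟨t, ht⟩ := spectrum_nonempty hT
      exact hcon ⟨t, ht, by simp⟩
  · have := isUnit_aeval hT _ h0 h
    rw [map_sub, aeval_C] at this
    exact spectrum.mem_iff.mp hr this

theorem norm_aeval {T : H →L[ℝ] H} (hT : IsSelfAdjoint T) [CompactSpace (spectrum ℝ T)] (p : ℝ[X]) :
    ‖aeval T p‖ = ‖toContinuousMapOnAlgHom (spectrum ℝ T) p‖ := by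
  have hr := ContinuousLinearMap.spectralRadius_eq_nnnorm _ (isSelfAdjoint_aeval hT p)
  apply le_antisymm
  · have : (‖aeval T p‖₊ : ENNReal) ≤ ‖toContinuousMapOnAlgHom (spectrum ℝ T) p‖₊ := by
      rw [← hr]
      refine iSup₂_le fun k hk => ?_
      obtain ⟨t, ht, rfl⟩ := spectrum_aeval hT p hk
      exact_mod_cast (toContinuousMapOnAlgHom (spectrum ℝ T) p).norm_coe_le_norm ⟨t, ht⟩
    exact_mod_cast this
  · rw [ContinuousMap.norm_le _ (norm_nonneg _)]
    rintro ⟨t, ht⟩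
    have hmem : p.eval t ∈ spectrum ℝ (aeval T p) :=
      spectrum.subset_polynomial_aeval T p ⟨t, ht, rfl⟩
    have : (‖p.eval t‖₊ : ENNReal) ≤ ‖aeval T p‖₊ := by
      rw [← hr]
      exact le_iSup₂_of_le (p.eval t) hmem le_rfl
    exact_mod_cast this

theorem exists_functionalCalculus {T : H →L[ℝ] H} (hT : IsSelfAdjoint T) :
    ∃ Φ : C(spectrum ℝ T, ℝ) →⋆ₐ[ℝ] (H →L[ℝ] H), (∀ f, ‖Φ f‖ = ‖f‖) ∧
      Φ ((ContinuousMap.id ℝ).restrict (spectrum ℝ T)) = T ∧ ∀ f, IsSelfAdjoint (Φ f) := by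
  have : CompactSpace (spectrum ℝ T) := isCompact_iff_compactSpace.mp (spectrum.isCompact T)
  let s := spectrum ℝ T
  let R : Subalgebra ℝ (C(s, ℝ) × (H →L[ℝ] H)) :=
    ((toContinuousMapOnAlgHom s).prod (aeval T)).range
  let M := R.topologicalClosure
  have hRM : R ≤ M := R.le_topologicalClosure
  have hM : ∀ z ∈ M, ‖z.2‖ = ‖z.1‖ ∧ star z.2 = z.2 := by
    have hcl : IsClosed {z : C(s, ℝ) × (H →L[ℝ] H) | ‖z.2‖ = ‖z.1‖ ∧ star z.2 = z.2} :=
      (isClosed_eq (by fun_prop) (by fun_prop)).inter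
        (isClosed_eq (continuous_star.comp continuous_snd) continuous_snd)
    refine fun z hz => closure_minimal ?_ hcl hz
    rintro _ ⟨p, rfl⟩
    exact ⟨norm_aeval hT p, (isSelfAdjoint_aeval hT p).star_eq⟩
  let π : M →ₐ[ℝ] C(s, ℝ) := (AlgHom.fst ℝ _ _).comp M.val
  have hπ : Isometry π := by
    refine AddMonoidHomClass.isometry_of_norm π fun z => ?_
    change ‖z.1.1‖ = max ‖z.1.1‖ ‖z.1.2‖
    rw [(hM z.1 z.2).1, max_self]
  have hMc : IsClosed (M : Set (C(s, ℝ) × (H →L[ℝ] H))) := R.isClosed_topologicalClosure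
  have : CompleteSpace M := hMc.completeSpace_coe
  have hsurj : Function.Surjective π := by
    have hcl : IsClosed (Set.range π) := hπ.isClosedEmbedding.isClosed_range
    have hsub : (polynomialFunctions s : Set C(s, ℝ)) ⊆ Set.range π := by
      rintro _ ⟨p, -, rfl⟩
      exact ⟨⟨_, hRM ⟨p, rfl⟩⟩, rfl⟩
    intro f
    have hf : f ∈ (polynomialFunctions s).topologicalClosure := by
      rw [polynomialFunctions.topologicalClosure]; trivial
    exact closure_minimal hsub hcl hf
  let e : M ≃ₐ[ℝ] C(s, ℝ) := AlgEquiv.ofBijective π ⟨hπ.injective, hsurj⟩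
  let Ψ : C(s, ℝ) →ₐ[ℝ] (H →L[ℝ] H) :=
    ((AlgHom.snd ℝ _ _).comp M.val).comp (e.symm : C(s, ℝ) →ₐ[ℝ] M)
  have hfst : ∀ f, (e.symm f).1.1 = f := fun f => e.apply_symm_apply f
  have hsa : ∀ f, star (Ψ f) = Ψ f := fun f => (hM _ (e.symm f).2).2
  refine ⟨{ Ψ with map_star' := fun f => ?_ }, fun f => ?_, ?_, fun f => hsa f⟩
  · have : star f = f := by ext; simp
    change Ψ (star f) = star (Ψ f)
    rw [this, hsa]
  · change ‖(e.symm f).1.2‖ = ‖f‖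
    rw [(hM _ (e.symm f).2).1, hfst]
  · have : e ⟨_, hRM ⟨X, rfl⟩⟩ = (ContinuousMap.id ℝ).restrict s := by
      change toContinuousMapOnAlgHom s X = _
      ext; simp
    change (e.symm ((ContinuousMap.id ℝ).restrict s)).1.2 = T
    rw [← this, e.symm_apply_apply]
    exact aeval_X T

/-- The continuous functional calculus for bounded self-adjoint operators on a real Hilbert
space. -/
instance instContinuousFunctionalCalculus :
    ContinuousFunctionalCalculus ℝ (H →L[ℝ] H) IsSelfAdjoint where
  predicate_zero := IsSelfAdjoint.zero _
  compactSpace_spectrum T := isCompact_iff_compactSpace.mp (spectrum.isCompact T)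
  spectrum_nonempty T hT := by
    have : Nontrivial H := by
      by_contra h
      rw [not_nontrivial_iff_subsingleton] at h
      exact not_subsingleton (H →L[ℝ] H) inferInstance
    exact spectrum_nonempty hT
  exists_cfc_of_predicate T hT := by
    have : CompactSpace (spectrum ℝ T) := isCompact_iff_compactSpace.mp (spectrum.isCompact T)
    obtain ⟨Φ, hnorm, hid, hsa⟩ := exists_functionalCalculus hT
    have hiso : Isometry Φ := AddMonoidHomClass.isometry_of_norm Φ hnorm
    refine ⟨Φ, hiso.continuous, hiso.injective, hid, fun f => ?_, hsa⟩
    apply subset_antisymm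
    · rw [← ContinuousMap.spectrum_eq_range f]
      exact AlgHom.spectrum_apply_subset Φ f
    · rintro _ ⟨t, rfl⟩
      rw [spectrum.mem_iff]
      intro hu
      set g : C(spectrum ℝ T, ℝ) := algebraMap ℝ _ (f t) - f with hg
      have hΦg : Φ g = algebraMap ℝ (H →L[ℝ] H) (f t) - Φ f := by
        rw [hg, map_sub, AlgHomClass.commutes]
      rw [← hΦg] at hu
      obtain ⟨u, hu⟩ := hu
      have hgt : g t = 0 := by simp [hg]
      set ε : ℝ := 1 / (2 * (‖(↑u⁻¹ : H →L[ℝ] H)‖ + 1)) with hε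
      have hεpos : 0 < ε := by positivity
      let h : C(spectrum ℝ T, ℝ) := ⟨fun y => max 0 (1 - |g y| / ε), by fun_prop⟩
      have hht : h t = 1 := by simp [h, hgt]
      have h1 : 1 ≤ ‖h‖ := by
        have := h.norm_coe_le_norm t
        rwa [hht, norm_one] at this
      have h2 : ‖g * h‖ ≤ ε := by
        rw [ContinuousMap.norm_le _ hεpos.le]
        intro y
        change |g y * max 0 (1 - |g y| / ε)| ≤ ε
        rw [abs_mul, abs_of_nonneg (le_max_left 0 (1 - |g y| / ε))]
        rcases le_total (1 - |g y| / ε) 0 with hle | hle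
        · rw [max_eq_left hle, mul_zero]; exact hεpos.le
        · rw [max_eq_right hle]
          have hgy : |g y| ≤ ε := by
            rw [sub_nonneg, div_le_one hεpos] at hle; exact hle
          have h3 : 1 - |g y| / ε ≤ 1 := by
            have : 0 ≤ |g y| / ε := by positivity
            linarith
          nlinarith [abs_nonneg (g y)]
      have h4 : Φ h = (↑u⁻¹ : H →L[ℝ] H) * Φ (g * h) := by
        rw [map_mul, ← hu, ← mul_assoc, Units.inv_mul, one_mul]
      have h5 : ‖h‖ ≤ ‖(↑u⁻¹ : H →L[ℝ] H)‖ * ε := by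
        calc ‖h‖ = ‖Φ h‖ := (hnorm h).symm
          _ ≤ ‖(↑u⁻¹ : H →L[ℝ] H)‖ * ‖Φ (g * h)‖ := by rw [h4]; exact norm_mul_le _ _
          _ ≤ _ := by rw [hnorm]; gcongr
      have h6 : ‖(↑u⁻¹ : H →L[ℝ] H)‖ * ε < 1 := by
        rw [hε, mul_one_div, div_lt_one (by positivity)]
        linarith [norm_nonneg (↑u⁻¹ : H →L[ℝ] H)]
      linarith

end RealFunctionalCalculus

namespace HilbertSchmidt

open scoped ENNReal

variable {H : Type*} [NormedAddCommGroup H] [InnerProductSpace ℝ H]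

theorem tsum_enorm_inner_sq {ι : Type*} (b : HilbertBasis ι ℝ H) (v : H) :
    ∑' i, ‖inner ℝ (b i) v‖ₑ ^ 2 = ‖v‖ₑ ^ 2 := by
  have h : HasSum (fun i => ‖inner ℝ (b i) v‖ ^ 2) (‖v‖ ^ 2) := by
    have := b.hasSum_inner_mul_inner v v
    rw [real_inner_self_eq_norm_sq] at this
    refine this.congr_fun ?_
    intro i
    rw [Real.norm_eq_abs, sq_abs, real_inner_comm (b i) v, sq]
  have h2 : ∀ x : ℝ, ‖x‖ₑ ^ 2 = ENNReal.ofReal (‖x‖ ^ 2) := fun x => by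
    rw [ENNReal.ofReal_pow (norm_nonneg _), ofReal_norm]
  simp_rw [h2]
  rw [← ENNReal.ofReal_tsum_of_nonneg (fun i => by positivity) h.summable, h.tsum_eq,
    ENNReal.ofReal_pow (norm_nonneg _), ofReal_norm]

variable [CompleteSpace H]

/-- The Hilbert-Schmidt norm `(∑ ‖T e‖²)^(1/2)`, the sum running over an orthonormal (Hilbert) basis
of `H`; the value is `∞` exactly when `T` is not Hilbert-Schmidt. It does not depend on the basis,
see `hsNorm_eq`. -/
noncomputable def hsNorm (T : H →L[ℝ] H) : ℝ≥0∞ :=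
  (∑' e : (exists_hilbertBasis ℝ H).choose, ‖T e‖ₑ ^ 2) ^ (1 / 2 : ℝ)

theorem tsum_enorm_sq_eq_adjoint {ι κ : Type*} (b : HilbertBasis ι ℝ H) (c : HilbertBasis κ ℝ H)
    (T : H →L[ℝ] H) :
    ∑' i, ‖T (b i)‖ₑ ^ 2 = ∑' j, ‖ContinuousLinearMap.adjoint T (c j)‖ₑ ^ 2 := by
  simp_rw [← tsum_enorm_inner_sq c (T _), ← tsum_enorm_inner_sq b (ContinuousLinearMap.adjoint T _)]
  rw [ENNReal.tsum_comm]
  simp_rw [ContinuousLinearMap.adjoint_inner_right, real_inner_comm]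

theorem hsNorm_eq {ι : Type*} (b : HilbertBasis ι ℝ H) (T : H →L[ℝ] H) :
    hsNorm T = (∑' i, ‖T (b i)‖ₑ ^ 2) ^ (1 / 2 : ℝ) := by
  obtain ⟨c, hc⟩ := (exists_hilbertBasis ℝ H).choose_spec
  rw [tsum_enorm_sq_eq_adjoint b c, ← tsum_enorm_sq_eq_adjoint c c, hsNorm, hc]

end HilbertSchmidt

namespace KernelLearning

open MeasureTheory
open scoped ENNReal

section

variable (H : Type*) {X : Type*} [NormedAddCommGroup H] [InnerProductSpace ℝ H] [CompleteSpace H]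
  [RKHS ℝ H X ℝ]

/-- The real-valued reproducing kernel `K` of the space `H` of real functions on `X`. -/
noncomputable def kernel (x y : X) : ℝ := RKHS.kernel H x y 1

/-- `K` is jointly measurable and `sup K(x, x) < ∞`. -/
structure IsBoundedMeasurableKernel [MeasurableSpace X] : Prop where
  measurable : Measurable fun p : X × X => kernel H p.1 p.2
  bounded : BddAbove (Set.range fun x : X => kernel H x x)

variable {H}

theorem norm_apply_le (f : H) (x : X) : ‖f x‖ ≤ √(kernel H x x) * ‖f‖ := by
  have h : ‖RKHS.kernel H x x‖ = kernel H x x := by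
    have h0 : RKHS.kernel H x x = kernel H x x • ContinuousLinearMap.id ℝ ℝ := by
      ext; simp [kernel]
    have h1 : 0 ≤ kernel H x x := by
      have := RKHS.kernel_inner H x x (1 : ℝ) (1 : ℝ)
      rw [real_inner_self_eq_norm_sq] at this
      have h2 : kernel H x x = ‖RKHS.kerFun H x (1 : ℝ)‖ ^ 2 := by
        rw [← this]; simp [kernel]
      rw [h2]; positivity
    rw [h0, norm_smul, ContinuousLinearMap.norm_id, mul_one, Real.norm_of_nonneg h1]
  rw [← h, mul_comm]
  exact RKHS.norm_apply_le f x

variable [MeasurableSpace X]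

theorem IsBoundedMeasurableKernel.measurable_coe (hK : IsBoundedMeasurableKernel H) (f : H) :
    Measurable (f : X → ℝ) := by
  let M : Submodule ℝ H :=
    { carrier := {g | Measurable (g : X → ℝ)}
      add_mem' := fun {a b} ha hb => by
        change Measurable ((a + b : H) : X → ℝ)
        rw [RKHS.coe_add]; exact Measurable.add ha hb
      zero_mem' := by
        change Measurable ((0 : H) : X → ℝ)
        rw [RKHS.coe_zero]; exact measurable_const
      smul_mem' := fun c {a} ha => by
        change Measurable ((c • a : H) : X → ℝ)
        rw [RKHS.coe_smul]; exact Measurable.const_smul ha c }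
  have hMc : IsClosed (M : Set H) := by
    refine isClosed_of_closure_subset fun g hg => ?_
    obtain ⟨u, hu, hlim⟩ := mem_closure_iff_seq_limit.mp hg
    refine measurable_of_tendsto_metrizable (f := fun k => (u k : X → ℝ)) hu ?_
    rw [tendsto_pi_nhds]
    exact fun x => ((RKHS.continuous_eval (𝕜 := ℝ) x).tendsto g).comp hlim
  have hle : Submodule.span ℝ {RKHS.kerFun H x v | (x : X) (v : ℝ)} ≤ M := by
    rw [Submodule.span_le]
    rintro _ ⟨y, v, rfl⟩
    change Measurable fun x => RKHS.kerFun H y v x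
    have : (fun x => RKHS.kerFun H y v x) = fun x => v * kernel H x y := by
      ext x
      rw [RKHS.kerFun_apply, kernel, ← smul_eq_mul v, ← map_smul, smul_eq_mul, mul_one]
    rw [this]
    exact (hK.measurable.comp (measurable_id.prodMk measurable_const)).const_mul v
  have hf : f ∈ (Submodule.span ℝ {RKHS.kerFun H x v | (x : X) (v : ℝ)}).topologicalClosure := by
    rw [RKHS.kerFun_dense]; trivial
  exact Submodule.topologicalClosure_minimal _ hle hMc hf

theorem IsBoundedMeasurableKernel.norm_apply_le (hK : IsBoundedMeasurableKernel H) (f : H)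
    (x : X) : ‖f x‖ ≤ √(⨆ y, kernel H y y) * ‖f‖ :=
  (KernelLearning.norm_apply_le f x).trans (by gcongr; exact le_ciSup hK.bounded x)

theorem IsBoundedMeasurableKernel.memLp (hK : IsBoundedMeasurableKernel H) (ρX : Measure X)
    [IsFiniteMeasure ρX] (f : H) : MemLp (f : X → ℝ) 2 ρX :=
  MemLp.of_bound (hK.measurable_coe f).aestronglyMeasurable _
    (Filter.Eventually.of_forall (hK.norm_apply_le f))

/-- The inclusion `ι : H → L²(X, ρ_X)`. -/
noncomputable def inclusion (hK : IsBoundedMeasurableKernel H) (ρX : Measure X)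
    [IsProbabilityMeasure ρX] : H →L[ℝ] Lp ℝ 2 ρX :=
  LinearMap.mkContinuous
    { toFun := fun f => (hK.memLp ρX f).toLp f
      map_add' := fun f g => MemLp.toLp_congr _ ((hK.memLp ρX f).add (hK.memLp ρX g))
        (Filter.Eventually.of_forall fun t => by rw [RKHS.coe_add])
      map_smul' := fun c f => MemLp.toLp_congr _ ((hK.memLp ρX f).const_smul c)
        (Filter.Eventually.of_forall fun t => by rw [RKHS.coe_smul]) }
    √(⨆ y, kernel H y y) (fun f => by
      refine (Lp.norm_le_of_ae_bound (by positivity)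
        ((hK.memLp ρX f).coeFn_toLp.mono fun x hx => hx ▸ hK.norm_apply_le f x)).trans ?_
      simp [measureUnivNNReal])

/-- The kernel second moment operator `B = ι* ι : H → H`. -/
noncomputable def secondMoment (hK : IsBoundedMeasurableKernel H) (ρX : Measure X)
    [IsProbabilityMeasure ρX] : H →L[ℝ] H :=
  ContinuousLinearMap.adjoint (inclusion hK ρX) ∘L inclusion hK ρX

theorem inner_secondMoment_apply (hK : IsBoundedMeasurableKernel H) (ρX : Measure X)
    [IsProbabilityMeasure ρX] (f g : H) :
    inner ℝ (secondMoment hK ρX f) g = ∫ t, f t * g t ∂ρX := by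
  change inner ℝ (ContinuousLinearMap.adjoint (inclusion hK ρX) (inclusion hK ρX f)) g = _
  rw [ContinuousLinearMap.adjoint_inner_left, L2.inner_def]
  refine integral_congr_ae ?_
  filter_upwards [(hK.memLp ρX f).coeFn_toLp, (hK.memLp ρX g).coeFn_toLp] with t hf hg
  change inner ℝ ((hK.memLp ρX f).toLp f t) ((hK.memLp ρX g).toLp g t) = _
  rw [hf, hg]
  simp [mul_comm]

end

section

variable {H X : Type*} [NormedAddCommGroup H] [InnerProductSpace ℝ H] [CompleteSpace H]
  [RKHS ℝ H X ℝ] {n : ℕ}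

/-- The sampling operator `ι_x : H → ℝⁿ`, `(ι_x f)_i = f (x_i)`. -/
noncomputable def sampling (H : Type*) {X : Type*} [NormedAddCommGroup H] [InnerProductSpace ℝ H]
    [CompleteSpace H] [RKHS ℝ H X ℝ] {n : ℕ} (x : Fin n → X) : H →L[ℝ] EuclideanSpace ℝ (Fin n) :=
  (EuclideanSpace.equiv (Fin n) ℝ).symm.toContinuousLinearMap ∘L
    ContinuousLinearMap.pi fun i => ContinuousLinearMap.proj (x i) ∘L RKHS.coeCLM ℝ

/-- The adjoint of the sampling operator when `ℝⁿ` carries the normalized inner product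
`⟨u, v⟩ = n⁻¹ ∑ uᵢ vᵢ`, that is `n⁻¹` times the adjoint for the Euclidean inner product. -/
noncomputable def samplingAdjoint (x : Fin n → X) : EuclideanSpace ℝ (Fin n) →L[ℝ] H :=
  (n : ℝ)⁻¹ • ContinuousLinearMap.adjoint (sampling H x)

/-- The empirical second moment operator `B_x = ι_x* ι_x : H → H`. -/
noncomputable def empiricalSecondMoment (H : Type*) {X : Type*} [NormedAddCommGroup H]
    [InnerProductSpace ℝ H] [CompleteSpace H] [RKHS ℝ H X ℝ] {n : ℕ} (x : Fin n → X) : H →L[ℝ] H :=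
  samplingAdjoint x ∘L sampling H x

theorem empiricalSecondMoment_apply (x : Fin n → X) (f : H) :
    empiricalSecondMoment H x f = (n : ℝ)⁻¹ • ∑ i, f (x i) • RKHS.kerFun H (x i) 1 := by
  refine ext_inner_right ℝ fun g => ?_
  change inner ℝ ((n : ℝ)⁻¹ • ContinuousLinearMap.adjoint (sampling H x) (sampling H x f)) g = _
  rw [inner_smul_left, inner_smul_left, ContinuousLinearMap.adjoint_inner_left, sum_inner,
    PiLp.inner_apply]
  congr 1
  refine Finset.sum_congr rfl fun i _ => ?_
  rw [inner_smul_left, RKHS.kerFun_inner]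
  change inner ℝ (f (x i)) (g (x i)) = _
  simp [mul_comm]

end

/-- `Ψ = ‖(I + S)^{-1/2} (S - S')‖_HS`, with value `∞` if that operator is not Hilbert-Schmidt. -/
noncomputable def psi {H : Type*} [NormedAddCommGroup H] [InnerProductSpace ℝ H] [CompleteSpace H]
    (S S' : H →L[ℝ] H) : ℝ≥0∞ :=
  HilbertSchmidt.hsNorm (cfc (fun t : ℝ => t ^ (-(1 / 2) : ℝ)) (1 + S) * (S - S'))

end KernelLearning

/-!
Write `A = 1 + S`, `B = 1 + Sₓ`, `D = A - B = S - Sₓ` and `Ψ = ‖A^(-1/2) D‖_HS`. Both `S` and `Sₓ`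
are positive and Hilbert–Schmidt, the former because the kernel is bounded
(`KernelLearning.hsNorm_secondMoment_ne_top`), the latter because finitely many points are sampled
(`KernelLearning.hsNorm_empiricalSecondMoment_ne_top`);
in particular `Ψ` is finite and `A`, `B` have Hilbert bases of eigenvectors, with eigenvalues at
least `1`.

The basic estimate is `‖A B⁻¹ - 1‖_HS ≤ Ψ (Ψ + 1)`. It follows from the factorization
`A B⁻¹ - 1 = (D A^(-1/2)) (A^(-1/2) + A^(-1/2) D B⁻¹)`, in which `D A^(-1/2)` is the adjoint of
`A^(-1/2) D` (`RealFunctionalCalculus.hsNorm_mul_cfc_inv_sub_one_le`). It gives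
`‖A B⁻¹‖ ≤ 1 + Ψ (Ψ + 1) ≤ (Ψ + 1)²`.

For a nondecreasing sublinear `φ`, the scalar inequality `|φ a / φ b - 1| ≤ |a / b - 1|` holds for
all positive `a` and `b` (`KernelLearning.abs_div_sub_one_le_of_antitoneOn_div`). Let `e`, `f` be
eigenvectors of `A`, `B` with eigenvalues `a`, `b`. The entry of `φ(A) φ(B)⁻¹ - 1` at `(e, f)` is
`(φ a / φ b - 1) ⟪e, f⟫`, so it is dominated by the same entry of `A B⁻¹ - 1`. Summing squares
transfers the basic estimate to `φ`
(`RealFunctionalCalculus.hsNorm_cfc_mul_cfc_inv_sub_one_le`). The passage through Hilbert–Schmidt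
norms is essential here, as `φ` need not be operator monotone.

For powers `0 ≤ r ≤ 1` the sharper bound is the Cordes inequality `‖A^r B^(-r)‖ ≤ ‖A B⁻¹‖^r`
(`RealFunctionalCalculus.norm_cfc_rpow_mul_le`). The function `r ↦ ‖A^r B^(-r)‖` is midpoint
log-convex, because the norm of a self-adjoint operator is its spectral radius, which is invariant
under cyclic permutation of factors; log-convexity follows by continuity.
-/

/-! ### Hilbert–Schmidt operators -/

namespace HilbertSchmidt

open scoped ENNReal

variable {H : Type*} [NormedAddCommGroup H] [InnerProductSpace ℝ H] [CompleteSpace H]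

theorem hsNorm_sq {ι : Type*} (b : HilbertBasis ι ℝ H) (T : H →L[ℝ] H) :
    hsNorm T ^ 2 = ∑' i, ‖T (b i)‖ₑ ^ 2 := by
  rw [hsNorm_eq b, ← ENNReal.rpow_natCast, ← ENNReal.rpow_mul]
  norm_num

theorem hsNorm_ne_top_iff {ι : Type*} (b : HilbertBasis ι ℝ H) {T : H →L[ℝ] H} :
    hsNorm T ≠ ⊤ ↔ ∑' i, ‖T (b i)‖ₑ ^ 2 ≠ ⊤ := by
  rw [← hsNorm_sq b]
  simp

theorem hsNorm_adjoint (T : H →L[ℝ] H) : hsNorm (ContinuousLinearMap.adjoint T) = hsNorm T := by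
  obtain ⟨w, b, -⟩ := exists_hilbertBasis ℝ H
  rw [hsNorm_eq b, hsNorm_eq b, ← tsum_enorm_sq_eq_adjoint b b]

theorem enorm_comp_sq_le {F G : Type*} [NormedAddCommGroup F] [NormedSpace ℝ F]
    [NormedAddCommGroup G] [NormedSpace ℝ G] (T : F →L[ℝ] G) (v : F) :
    ‖T v‖ₑ ^ 2 ≤ ‖T‖ₑ ^ 2 * ‖v‖ₑ ^ 2 := by
  rw [← mul_pow]
  gcongr
  exact T.le_opENorm v

theorem hsNorm_mul_le_left (T R : H →L[ℝ] H) : hsNorm (T * R) ≤ ‖T‖ₑ * hsNorm R := by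
  obtain ⟨w, b, -⟩ := exists_hilbertBasis ℝ H
  rw [← ENNReal.pow_le_pow_left_iff two_ne_zero, mul_pow, hsNorm_sq b, hsNorm_sq b,
    ← ENNReal.tsum_mul_left]
  exact ENNReal.tsum_le_tsum fun i => enorm_comp_sq_le T (R (b i))

theorem hsNorm_mul_le_right (T R : H →L[ℝ] H) : hsNorm (T * R) ≤ hsNorm T * ‖R‖ₑ := by
  rw [← hsNorm_adjoint, ← hsNorm_adjoint T, mul_comm]
  have h : ‖ContinuousLinearMap.adjoint R‖ₑ = ‖R‖ₑ := by
    rw [← ofReal_norm, ← ofReal_norm, LinearIsometryEquiv.norm_map]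
  rw [← h]
  have h2 : ContinuousLinearMap.adjoint (T * R) =
    ContinuousLinearMap.adjoint R * ContinuousLinearMap.adjoint T :=
    ContinuousLinearMap.adjoint_comp T R
  rw [h2]
  exact hsNorm_mul_le_left _ _

/-- The operator norm is dominated by the Hilbert–Schmidt norm. -/
theorem enorm_le_hsNorm (T : H →L[ℝ] H) : ‖T‖ₑ ≤ hsNorm T := by
  obtain ⟨w, b, -⟩ := exists_hilbertBasis ℝ H
  refine ContinuousLinearMap.opENorm_le_bound _ fun v => ?_
  rw [← hsNorm_adjoint, ← ENNReal.pow_le_pow_left_iff two_ne_zero, mul_pow, hsNorm_sq b,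
    ← ENNReal.tsum_mul_right, ← tsum_enorm_inner_sq b]
  refine ENNReal.tsum_le_tsum fun i => ?_
  rw [← ContinuousLinearMap.adjoint_inner_left, ← mul_pow]
  gcongr
  rw [← ofReal_norm, ← ofReal_norm, ← ofReal_norm, ← ENNReal.ofReal_mul (norm_nonneg _)]
  exact ENNReal.ofReal_le_ofReal (norm_inner_le_norm _ _)

theorem hsNorm_sub_ne_top {T R : H →L[ℝ] H} (hT : hsNorm T ≠ ⊤) (hR : hsNorm R ≠ ⊤) :
    hsNorm (T - R) ≠ ⊤ := by
  obtain ⟨w, b, -⟩ := exists_hilbertBasis ℝ H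
  rw [hsNorm_ne_top_iff b] at *
  have h : ∑' i, (2 : ℝ≥0∞) * (‖T (b i)‖ₑ ^ 2 + ‖R (b i)‖ₑ ^ 2) ≠ ⊤ := by
    rw [ENNReal.tsum_mul_left, ENNReal.tsum_add]
    exact ENNReal.mul_ne_top (by simp) (ENNReal.add_ne_top.mpr ⟨hT, hR⟩)
  refine ne_top_of_le_ne_top h (ENNReal.tsum_le_tsum fun i => ?_)
  have h2 := ENNReal.rpow_add_le_mul_rpow_add_rpow ‖T (b i)‖ₑ ‖R (b i)‖ₑ (p := 2) (by norm_num)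
  norm_num at h2
  refine le_trans ?_ h2
  gcongr
  exact enorm_sub_le

/-- A Hilbert–Schmidt operator is compact: it is the limit in Hilbert–Schmidt norm, hence in
operator norm, of its finite-rank truncations `∑ i ∈ s, ⟪b i, ·⟫ T (b i)`. -/
theorem isCompactOperator_of_hsNorm_ne_top {T : H →L[ℝ] H} (hT : hsNorm T ≠ ⊤) :
    IsCompactOperator T := by
  classical
  obtain ⟨w, b, -⟩ := exists_hilbertBasis ℝ H
  let F : Finset w → H →L[ℝ] H := fun s => ∑ i ∈ s, (innerSL ℝ (b i)).smulRight (T (b i))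
  have hF : ∀ s, IsCompactOperator (F s) := fun s => by
    have : F s ∈ compactOperator (RingHom.id ℝ) H H := by
      refine Submodule.sum_mem _ fun i _ => ?_
      change IsCompactOperator ((ContinuousLinearMap.toSpanSingleton ℝ (T (b i))) ∘L
        (innerSL ℝ (b i)))
      exact (isCompactOperator_of_locallyCompactSpace_rng
        (ContinuousLinearMap.toSpanSingleton ℝ (T (b i)))).comp_clm _
    exact this
  have hval : ∀ s i, (T - F s) (b i) = if i ∈ s then 0 else T (b i) := fun s i => by
    have h : F s (b i) = ∑ j ∈ s, if j = i then T (b j) else 0 := by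
      simp only [F, sum_apply]
      refine Finset.sum_congr rfl fun j _ => ?_
      rw [ContinuousLinearMap.smulRight_apply, innerSL_apply_apply,
        orthonormal_iff_ite.mp b.orthonormal, ite_smul, one_smul, zero_smul]
    rw [sub_apply, h, Finset.sum_ite_eq' s i fun j => T (b j)]
    split_ifs <;> simp
  have hsq : ∀ s, ‖T - F s‖ₑ ^ 2 ≤ ∑' i : {i // i ∉ s}, ‖T (b i)‖ₑ ^ 2 := fun s => by
    refine (pow_le_pow_left₀ zero_le (enorm_le_hsNorm _) 2).trans_eq ?_
    rw [hsNorm_sq b]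
    simp_rw [hval]
    refine Eq.trans ?_ (tsum_subtype {i | i ∉ s} fun i => ‖T (b i)‖ₑ ^ 2).symm
    refine tsum_congr fun i => ?_
    by_cases hi : i ∈ s <;> simp [hi]
  have hlim : Filter.Tendsto (fun s => ‖T - F s‖ₑ ^ 2) Filter.atTop (nhds 0) :=
    tendsto_of_tendsto_of_tendsto_of_le_of_le tendsto_const_nhds
      (ENNReal.tendsto_tsum_compl_atTop_zero ((hsNorm_ne_top_iff b).mp hT))
      (fun _ => zero_le) hsq
  have hlim2 : Filter.Tendsto F Filter.atTop (nhds T) := by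
    rw [tendsto_iff_edist_tendsto_0]
    have h := (ENNReal.continuous_rpow_const (y := 1 / 2)).tendsto 0 |>.comp hlim
    simp only [Function.comp_def] at h
    rw [ENNReal.zero_rpow_of_pos (by norm_num)] at h
    refine h.congr fun s => ?_
    rw [edist_comm, edist_eq_enorm_sub, ← ENNReal.rpow_natCast, ← ENNReal.rpow_mul]
    norm_num
  exact isCompactOperator_of_tendsto hlim2 (Filter.Eventually.of_forall hF)

/-- If the matrix of `T` is entrywise dominated by that of `R`, with respect to one Hilbert basis on
each side, then `‖T‖_HS ≤ ‖R‖_HS`. -/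
theorem hsNorm_le_of_abs_inner_le {ι κ : Type*} (b : HilbertBasis ι ℝ H) (c : HilbertBasis κ ℝ H)
    {T R : H →L[ℝ] H} (h : ∀ i j, |inner ℝ (b i) (T (c j))| ≤ |inner ℝ (b i) (R (c j))|) :
    hsNorm T ≤ hsNorm R := by
  rw [← ENNReal.pow_le_pow_left_iff two_ne_zero, hsNorm_sq c, hsNorm_sq c]
  refine ENNReal.tsum_le_tsum fun j => ?_
  rw [← tsum_enorm_inner_sq b, ← tsum_enorm_inner_sq b]
  refine ENNReal.tsum_le_tsum fun i => ?_
  gcongr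
  rw [← ofReal_norm, ← ofReal_norm]
  exact ENNReal.ofReal_le_ofReal (h i j)

theorem hsNorm_comp_ne_top {F : Type*} [NormedAddCommGroup F] [NormedSpace ℝ F] {ι : Type*}
    (b : HilbertBasis ι ℝ H) (D : F →L[ℝ] H) {C : H →L[ℝ] F}
    (hC : ∑' i, ‖C (b i)‖ₑ ^ 2 ≠ ⊤) : hsNorm (D ∘L C) ≠ ⊤ := by
  rw [hsNorm_ne_top_iff b]
  refine ne_top_of_le_ne_top ?_ (ENNReal.tsum_le_tsum fun i => enorm_comp_sq_le D (C (b i)))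
  rw [ENNReal.tsum_mul_left]
  exact ENNReal.mul_ne_top (by simp) hC

end HilbertSchmidt

namespace RealFunctionalCalculus

universe u

variable {H : Type u} [NormedAddCommGroup H] [InnerProductSpace ℝ H] [CompleteSpace H]

/-! ### Spectrum and eigenvectors -/

theorem spectrum_ge_of_forall_le_inner {T : H →L[ℝ] H} {m : ℝ}
    (h : ∀ v, m * ‖v‖ ^ 2 ≤ inner ℝ (T v) v) {t : ℝ} (ht : t ∈ spectrum ℝ T) : m ≤ t := by
  by_contra! hlt
  refine ht ?_
  rw [spectrum.mem_resolventSet_iff, ← IsUnit.neg_iff, neg_sub]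
  refine ContinuousLinearMap.isUnit_of_forall_le_norm_inner_map _
    (c := ⟨m - t, by linarith⟩) (by exact_mod_cast sub_pos.mpr hlt) fun v => ?_
  change ‖v‖ ^ 2 * (m - t) ≤ _
  rw [sub_apply, inner_sub_left, Algebra.algebraMap_eq_smul_one, smul_apply, one_apply_eq_self,
    inner_smul_left, real_inner_self_eq_norm_sq]
  refine le_trans ?_ (le_abs_self _)
  have := h v
  simp only [conj_trivial]
  linarith

omit [CompleteSpace H] in
theorem mem_spectrum_of_eigenvector {T : H →L[ℝ] H} {a : ℝ} {v : H} (hv : v ≠ 0)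
    (h : T v = a • v) : a ∈ spectrum ℝ T := by
  intro hu
  obtain ⟨u, hu⟩ := hu
  have h0 : (u : H →L[ℝ] H) v = 0 := by
    rw [hu, sub_apply, h, Algebra.algebraMap_eq_smul_one, smul_apply, one_apply_eq_self, sub_self]
  apply hv
  have : ((↑u⁻¹ * ↑u : H →L[ℝ] H)) v = 0 := by
    rw [mul_apply_eq_comp, h0, map_zero]
  rwa [Units.inv_mul] at this

theorem cfc_apply_eigenvector {T : H →L[ℝ] H} (hT : IsSelfAdjoint T) {a : ℝ} {v : H}
    (hv : v ≠ 0) (h : T v = a • v) {f : ℝ → ℝ} (hf : ContinuousOn f (spectrum ℝ T)) :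
    cfc f T v = f a • v := by
  have : CompactSpace (spectrum ℝ T) := isCompact_iff_compactSpace.mp (spectrum.isCompact T)
  have ha := mem_spectrum_of_eigenvector hv h
  rw [cfc_apply f T hT hf]
  suffices ∀ g : C(spectrum ℝ T, ℝ), cfcHom hT g v = g ⟨a, ha⟩ • v from this _
  intro g
  have hid : cfcHom hT (.restrict (spectrum ℝ T) <| .id ℝ) v = a • v := by
    rw [cfcHom_id, h]
  induction g using ContinuousMap.induction_on_of_compact with
  | const r =>
    have : ContinuousMap.const (spectrum ℝ T) r = algebraMap ℝ _ r := rfl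
    rw [this, AlgHomClass.commutes, Algebra.algebraMap_eq_smul_one]
    rfl
  | id => exact hid
  | star_id =>
    have : star (ContinuousMap.restrict (spectrum ℝ T) (.id ℝ)) = .restrict _ (.id ℝ) := by
      ext; simp
    rw [this]
    exact hid
  | add f g hf hg => rw [map_add, add_apply, hf, hg, ContinuousMap.add_apply, add_smul]
  | mul f g hf hg =>
    rw [map_mul, mul_apply_eq_comp, hg, map_smul, hf, smul_smul, ContinuousMap.mul_apply, mul_comm]
  | frequently f hfr =>
    have hcl : IsClosed {g : C(spectrum ℝ T, ℝ) | cfcHom hT g v = g ⟨a, ha⟩ • v} :=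
      isClosed_eq ((cfcHom_continuous hT).clm_apply continuous_const)
        ((continuous_eval_const _).smul continuous_const)
    exact hcl.mem_of_frequently_of_tendsto hfr Filter.tendsto_id

/-- The spectral theorem for compact self-adjoint operators in the form of a Hilbert basis of
eigenvectors. -/
theorem exists_hilbertBasis_eigenvectors {T : H →L[ℝ] H} (hT : IsSelfAdjoint T)
    (hc : IsCompactOperator T) :
    ∃ (ι : Type u) (b : HilbertBasis ι ℝ H) (a : ι → ℝ), ∀ i, T (b i) = a i • b i := by
  let E : ℝ → Submodule ℝ H := fun μ => Module.End.eigenspace (T : H →ₗ[ℝ] H) μ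
  have hmem : ∀ μ v, v ∈ E μ ↔ T v = μ • v := fun μ v => Module.End.mem_eigenspace_iff
  have hcomp : ∀ μ, CompleteSpace (E μ) := fun μ => by
    have hcl : IsClosed (E μ : Set H) := by
      have : (E μ : Set H) = {v | T v = μ • v} := by ext v; exact hmem μ v
      rw [this]
      exact isClosed_eq T.continuous (by fun_prop)
    exact hcl.completeSpace_coe
  have hex : ∀ μ, ∃ w : Set (E μ), Nonempty (HilbertBasis w ℝ (E μ)) := fun μ =>
    let ⟨w, b, _⟩ := exists_hilbertBasis ℝ (E μ)
    ⟨w, ⟨b⟩⟩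
  choose w hw using hex
  let b : ∀ μ, HilbertBasis (w μ) ℝ (E μ) := fun μ => (hw μ).some
  have hon := hT.isSymmetric.orthogonalFamily_eigenspaces.orthonormal_sigma_orthonormal
    (fun μ => (b μ).orthonormal)
  refine ⟨Σ μ, w μ, HilbertBasis.mkOfOrthogonalEqBot hon ?_, fun i => i.1, fun i => ?_⟩
  · rw [eq_bot_iff, ← ContinuousLinearMap.orthogonalComplement_iSup_eigenspaces_eq_bot hc
      hT.isSymmetric, ← Submodule.iInf_orthogonal]
    refine le_iInf fun μ v hv x hx => ?_
    have hzero : (innerSL ℝ v) ∘L (E μ).subtypeL = 0 := by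
      refine ContinuousLinearMap.ext_on (s := Set.range (b μ)) ?_ ?_
      · rw [dense_iff_closure_eq, ← Submodule.topologicalClosure_coe, (b μ).dense_span]
        rfl
      · rintro _ ⟨i, rfl⟩
        have := hv _ (Submodule.subset_span ⟨⟨μ, i⟩, rfl⟩)
        rw [real_inner_comm] at this
        exact this
    rw [real_inner_comm]
    exact DFunLike.congr_fun hzero ⟨x, hx⟩
  · rw [HilbertBasis.coe_mkOfOrthogonalEqBot]
    exact (hmem _ _).mp (b i.1 i.2).2

/-! ### The Cordes inequality -/

/-- The norm of a self-adjoint operator is its spectral radius, and `S * T` and `T * S` have the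
same spectrum away from zero. -/
theorem norm_mul_le_norm_mul_swap {S T : H →L[ℝ] H} (h : IsSelfAdjoint (S * T)) :
    ‖S * T‖ ≤ ‖T * S‖ := by
  rcases subsingleton_or_nontrivial H with hH | hH
  · rw [Subsingleton.elim (S * T) (T * S)]
  have h2 : (‖S * T‖₊ : ENNReal) ≤ ‖T * S‖₊ := by
    rw [← ContinuousLinearMap.spectralRadius_eq_nnnorm _ h]
    refine le_trans (iSup₂_le fun k hk => ?_) (spectrum.spectralRadius_le_nnnorm (𝕜 := ℝ) (T * S))
    by_cases hk0 : k = 0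
    · simp [hk0]
    · have hk' : k ∈ spectrum ℝ (T * S) \ {0} := by
        rw [← spectrum.nonzero_mul_comm]
        exact ⟨hk, hk0⟩
      exact le_iSup₂_of_le k hk'.1 le_rfl
  exact_mod_cast h2

theorem continuousOn_rpow_of_forall_pos {s : Set ℝ} (hs : ∀ t ∈ s, 0 < t) (r : ℝ) :
    ContinuousOn (fun t : ℝ => t ^ r) s :=
  continuousOn_id.rpow_const fun t ht => Or.inl (hs t ht).ne'

theorem cfc_rpow_add {T : H →L[ℝ] H} (hT : ∀ t ∈ spectrum ℝ T, 0 < t) (r s : ℝ) :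
    cfc (fun t : ℝ => t ^ (r + s)) T = cfc (fun t : ℝ => t ^ r) T * cfc (fun t : ℝ => t ^ s) T := by
  rw [← cfc_mul (fun t : ℝ => t ^ r) (fun t : ℝ => t ^ s) T
    (continuousOn_rpow_of_forall_pos hT r) (continuousOn_rpow_of_forall_pos hT s)]
  exact cfc_congr fun t ht => Real.rpow_add (hT t ht) r s

theorem continuous_cfc_rpow {T : H →L[ℝ] H} (hTsa : IsSelfAdjoint T)
    (hT : ∀ t ∈ spectrum ℝ T, 0 < t) : Continuous fun r : ℝ => cfc (fun t : ℝ => t ^ r) T := by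
  -- On the compact spectrum, joint continuity of `(r, t) ↦ t ^ r` makes `r ↦ t ^ r` continuous for
  -- the uniform norm.
  let F : C(ℝ × spectrum ℝ T, ℝ) := ⟨fun p => (p.2 : ℝ) ^ p.1,
    (continuous_subtype_val.comp continuous_snd).rpow continuous_fst
      fun p => Or.inl (hT _ p.2.2).ne'⟩
  refine ((cfcHom_continuous hTsa).comp F.curry.continuous).congr fun r => ?_
  rw [cfc_apply _ T hTsa (continuousOn_rpow_of_forall_pos hT r)]
  rfl

/-- The function `r ↦ ‖A ^ r B ^ (-r)‖` is midpoint log-convex. -/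
theorem norm_cfc_rpow_midpoint_le {A B : H →L[ℝ] H}
    (hA : ∀ t ∈ spectrum ℝ A, 0 < t) (hB : ∀ t ∈ spectrum ℝ B, 0 < t) (r s : ℝ) :
    ‖cfc (fun t : ℝ => t ^ ((r + s) / 2)) A * cfc (fun t : ℝ => t ^ (-((r + s) / 2))) B‖ ^ 2 ≤
      ‖cfc (fun t : ℝ => t ^ r) A * cfc (fun t : ℝ => t ^ (-r)) B‖ *
      ‖cfc (fun t : ℝ => t ^ s) A * cfc (fun t : ℝ => t ^ (-s)) B‖ := by
  let P : ℝ → H →L[ℝ] H := fun r => cfc (fun t : ℝ => t ^ r) A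
  let Q : ℝ → H →L[ℝ] H := fun r => cfc (fun t : ℝ => t ^ (-r)) B
  have hP : ∀ r s, P (r + s) = P r * P s := cfc_rpow_add hA
  have hQ : ∀ r s, Q (r + s) = Q r * Q s := fun r s => by
    simp only [Q, neg_add, cfc_rpow_add hB]
  have hPs : ∀ r, star (P r) = P r := fun r => cfc_predicate (p := IsSelfAdjoint) _ A
  have hQs : ∀ r, star (Q r) = Q r := fun r => cfc_predicate (p := IsSelfAdjoint) _ B
  set m := (r + s) / 2 with hm
  have hmm : m + m = r + s := by rw [hm]; ring
  -- Cycling the factor `B ^ (s - m)` turns `B ^ (-m) A ^ (r + s) B ^ (-m)` into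
  -- `(B ^ (-r) A ^ r) (A ^ s B ^ (-s))`.
  have hsplit : star (P m * Q m) * (P m * Q m) =
      (Q m * P r * (P s * Q s)) * Q (m - s) := by
    have h1 : Q m = Q s * Q (m - s) := by rw [← hQ]; congr 1; ring
    have h2 : P m * P m = P r * P s := by rw [← hP, ← hP, hmm]
    calc star (P m * Q m) * (P m * Q m) = Q m * (P m * P m) * Q m := by
          rw [star_mul, hPs, hQs]
          simp only [mul_assoc]
      _ = Q m * (P r * P s) * (Q s * Q (m - s)) := by rw [h2, ← h1]
      _ = _ := by simp only [mul_assoc]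
  have hmerge : Q (m - s) * (Q m * P r * (P s * Q s)) = (Q r * P r) * (P s * Q s) := by
    have h1 : Q (m - s) * Q m = Q r := by rw [← hQ]; congr 1; linarith
    rw [← h1]
    simp only [mul_assoc]
  change ‖P m * Q m‖ ^ 2 ≤ ‖P r * Q r‖ * ‖P s * Q s‖
  calc ‖P m * Q m‖ ^ 2 = ‖(Q m * P r * (P s * Q s)) * Q (m - s)‖ := by
        rw [← hsplit, sq]
        exact CStarRing.norm_star_mul_self.symm
    _ ≤ ‖Q (m - s) * (Q m * P r * (P s * Q s))‖ :=
        norm_mul_le_norm_mul_swap (hsplit ▸ IsSelfAdjoint.star_mul_self _)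
    _ = ‖(Q r * P r) * (P s * Q s)‖ := by rw [hmerge]
    _ ≤ ‖Q r * P r‖ * ‖P s * Q s‖ := norm_mul_le _ _
    _ = ‖P r * Q r‖ * ‖P s * Q s‖ := by
        rw [← norm_star (P r * Q r), star_mul, hPs, hQs]

/-- **Cordes inequality**: `‖A ^ r B ^ (-r)‖ ≤ c ^ r` for `0 ≤ r ≤ 1` as soon as `‖A B⁻¹‖ ≤ c`. -/
theorem norm_cfc_rpow_mul_le {A B : H →L[ℝ] H} (hAsa : IsSelfAdjoint A) (hBsa : IsSelfAdjoint B)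
    (hA : ∀ t ∈ spectrum ℝ A, 0 < t) (hB : ∀ t ∈ spectrum ℝ B, 0 < t) {c : ℝ} (hc : 0 < c)
    (h : ‖cfc (fun t : ℝ => t ^ (1 : ℝ)) A * cfc (fun t : ℝ => t ^ (-1 : ℝ)) B‖ ≤ c)
    {r : ℝ} (hr0 : 0 ≤ r) (hr1 : r ≤ 1) :
    ‖cfc (fun t : ℝ => t ^ r) A * cfc (fun t : ℝ => t ^ (-r)) B‖ ≤ c ^ r := by
  let g : ℝ → ℝ := fun r => ‖cfc (fun t : ℝ => t ^ r) A * cfc (fun t : ℝ => t ^ (-r)) B‖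
  let D : Set ℝ := {r | g r ≤ c ^ r}
  have hgc : Continuous g :=
    ((continuous_cfc_rpow hAsa hA).mul ((continuous_cfc_rpow hBsa hB).comp continuous_neg)).norm
  have hD : IsClosed D := isClosed_le hgc (Real.continuous_const_rpow hc.ne')
  have h0 : (0 : ℝ) ∈ D := by
    change ‖_‖ ≤ _
    simp only [Real.rpow_zero, neg_zero]
    rw [cfc_const_one ℝ A, cfc_const_one ℝ B, one_mul]
    exact ContinuousLinearMap.norm_id_le
  have h1 : (1 : ℝ) ∈ D := by
    change ‖_‖ ≤ _
    rwa [Real.rpow_one]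
  have hmid : ∀ a ∈ D, ∀ b ∈ D, (a + b) / 2 ∈ D := fun a ha b hb => by
    refine (sq_le_sq₀ (norm_nonneg _) (by positivity)).mp ?_
    calc g ((a + b) / 2) ^ 2 ≤ g a * g b := norm_cfc_rpow_midpoint_le hA hB a b
      _ ≤ c ^ a * c ^ b := mul_le_mul ha hb (norm_nonneg _) (by positivity)
      _ = (c ^ ((a + b) / 2)) ^ 2 := by
        rw [← Real.rpow_natCast, ← Real.rpow_mul hc.le, ← Real.rpow_add hc]
        congr 1
        push_cast
        ring
  -- A gap of the closed set `D` around `r` would have end points in `D`, and their midpoint too.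
  by_contra hr
  have hleft := (isCompact_Icc (a := (0 : ℝ)) (b := r)).inter_right hD
  have hright := (isCompact_Icc (a := r) (b := (1 : ℝ))).inter_right hD
  obtain ⟨a, ⟨ha, haD⟩, hamax⟩ := hleft.exists_isGreatest ⟨0, ⟨le_rfl, hr0⟩, h0⟩
  obtain ⟨b, ⟨hb, hbD⟩, hbmin⟩ := hright.exists_isLeast ⟨1, ⟨hr1, le_rfl⟩, h1⟩
  have har : a < r := lt_of_le_of_ne ha.2 fun e => hr (e ▸ haD)
  have hrb : r < b := lt_of_le_of_ne hb.1 fun e => hr (e ▸ hbD)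
  have hm := hmid a haD b hbD
  rcases le_total ((a + b) / 2) r with hle | hle
  · have := hamax ⟨⟨by linarith [ha.1], hle⟩, hm⟩
    linarith
  · have := hbmin ⟨⟨hle, by linarith [hb.2]⟩, hm⟩
    linarith

/-! ### Comparison of functions of two operators in Hilbert–Schmidt norm -/

open HilbertSchmidt

theorem enorm_cfc_le_one {T : H →L[ℝ] H} (hT : IsSelfAdjoint T) {f : ℝ → ℝ}
    (hf : ContinuousOn f (spectrum ℝ T)) (h : ∀ t ∈ spectrum ℝ T, |f t| ≤ 1) :
    ‖cfc f T‖ₑ ≤ 1 := by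
  have hsr := ContinuousLinearMap.spectralRadius_eq_nnnorm _
    (cfc_predicate (p := IsSelfAdjoint) f T)
  change ((‖cfc f T‖₊ : NNReal) : ENNReal) ≤ 1
  rw [← hsr]
  refine iSup₂_le fun k hk => ?_
  rw [cfc_map_spectrum f T hT hf] at hk
  obtain ⟨t, ht, rfl⟩ := hk
  exact_mod_cast h t ht

/-- Matrix entries of `f(A) g(B) - 1` between eigenvectors of `A` and of `B`. -/
theorem inner_cfc_mul_cfc_sub_one {A B : H →L[ℝ] H} (hA : IsSelfAdjoint A)
    (hB : IsSelfAdjoint B) {a b : ℝ} {v w : H} (hv0 : v ≠ 0) (hw0 : w ≠ 0) (hv : A v = a • v)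
    (hw : B w = b • w) {f g : ℝ → ℝ} (hf : ContinuousOn f (spectrum ℝ A))
    (hg : ContinuousOn g (spectrum ℝ B)) :
    inner ℝ v ((cfc f A * cfc g B - 1) w) = (f a * g b - 1) * inner ℝ v w := by
  have hsa : IsSelfAdjoint (cfc f A) := cfc_predicate f A
  have h : inner ℝ v (cfc f A w) = f a * inner ℝ v w := by
    have := hsa.isSymmetric v w
    change inner ℝ (cfc f A v) w = inner ℝ v (cfc f A w) at this
    rw [← this, cfc_apply_eigenvector hA hv0 hv hf, inner_smul_left, conj_trivial]
  rw [sub_apply, mul_apply_eq_comp, one_apply_eq_self, inner_sub_right,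
    cfc_apply_eigenvector hB hw0 hw hg, map_smul, inner_smul_right, h]
  ring

/-- If `|φ a / φ b - 1| ≤ |a / b - 1|` for all positive `a` and `b`, then
`‖φ(A) φ(B)⁻¹ - 1‖_HS ≤ ‖A B⁻¹ - 1‖_HS` for positive operators with bases of eigenvectors. The
comparison is one of matrix entries, which is why it is made in Hilbert–Schmidt norm. -/
theorem hsNorm_cfc_mul_cfc_inv_sub_one_le {ι κ : Type*} {A B : H →L[ℝ] H} (hA : IsSelfAdjoint A)
    (hB : IsSelfAdjoint B) (hApos : ∀ t ∈ spectrum ℝ A, 0 < t) (hBpos : ∀ t ∈ spectrum ℝ B, 0 < t)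
    (e : HilbertBasis ι ℝ H) {α : ι → ℝ} (he : ∀ i, A (e i) = α i • e i)
    (d : HilbertBasis κ ℝ H) {β : κ → ℝ} (hd : ∀ j, B (d j) = β j • d j) {φ : ℝ → ℝ}
    (hφpos : ∀ t, 0 < t → 0 < φ t) (hφc : ContinuousOn φ (Set.Ioi 0))
    (hφ : ∀ a b, 0 < a → 0 < b → |φ a / φ b - 1| ≤ |a / b - 1|) :
    hsNorm (cfc φ A * cfc (fun t => (φ t)⁻¹) B - 1) ≤
      hsNorm (cfc (fun t : ℝ => t ^ (1 : ℝ)) A * cfc (fun t : ℝ => t ^ (-1 : ℝ)) B - 1) := by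
  refine hsNorm_le_of_abs_inner_le e d fun i j => ?_
  have hi := e.orthonormal.ne_zero i
  have hj := d.orthonormal.ne_zero j
  have hαi : 0 < α i := hApos _ (mem_spectrum_of_eigenvector hi (he i))
  have hβj : 0 < β j := hBpos _ (mem_spectrum_of_eigenvector hj (hd j))
  rw [inner_cfc_mul_cfc_sub_one hA hB hi hj (he i) (hd j) (hφc.mono hApos)
      (g := fun t => (φ t)⁻¹) ((hφc.mono hBpos).inv₀ fun t ht => (hφpos t (hBpos t ht)).ne'),
    inner_cfc_mul_cfc_sub_one hA hB hi hj (he i) (hd j) (continuousOn_rpow_of_forall_pos hApos 1)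
      (continuousOn_rpow_of_forall_pos hBpos (-1)), abs_mul, abs_mul, Real.rpow_one,
    Real.rpow_neg_one]
  exact mul_le_mul_of_nonneg_right (hφ _ _ hαi hβj) (abs_nonneg _)

/-- With `D = A - B`, the identity `A B⁻¹ - 1 = (D A^(-1/2)) (A^(-1/2) + A^(-1/2) D B⁻¹)`
bounds `A B⁻¹ - 1` in terms of `A^(-1/2) D` and of its adjoint `D A^(-1/2)`. -/
theorem hsNorm_mul_cfc_inv_sub_one_le {A B : H →L[ℝ] H} (hA : IsSelfAdjoint A)
    (hB : IsSelfAdjoint B) (hA1 : ∀ t ∈ spectrum ℝ A, 1 ≤ t) (hB1 : ∀ t ∈ spectrum ℝ B, 1 ≤ t) :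
    hsNorm (cfc (fun t : ℝ => t ^ (1 : ℝ)) A * cfc (fun t : ℝ => t ^ (-1 : ℝ)) B - 1) ≤
      hsNorm (cfc (fun t : ℝ => t ^ (-(1 / 2) : ℝ)) A * (A - B)) *
        (hsNorm (cfc (fun t : ℝ => t ^ (-(1 / 2) : ℝ)) A * (A - B)) + 1) := by
  have hApos : ∀ t ∈ spectrum ℝ A, 0 < t := fun t ht => one_pos.trans_le (hA1 t ht)
  have hBpos : ∀ t ∈ spectrum ℝ B, 0 < t := fun t ht => one_pos.trans_le (hB1 t ht)
  have hle : ∀ {T : H →L[ℝ] H}, IsSelfAdjoint T → (∀ t ∈ spectrum ℝ T, 1 ≤ t) → ∀ r : ℝ, r ≤ 0 →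
      ‖cfc (fun t : ℝ => t ^ r) T‖ₑ ≤ 1 := fun hT h1 r hr =>
    enorm_cfc_le_one hT (continuousOn_rpow_of_forall_pos (fun t ht => one_pos.trans_le (h1 t ht)) r)
      fun t ht => by
        rw [abs_of_nonneg (Real.rpow_nonneg (zero_le_one.trans (h1 t ht)) r)]
        exact Real.rpow_le_one_of_one_le_of_nonpos (h1 t ht) hr
  have hone : ∀ {T : H →L[ℝ] H}, IsSelfAdjoint T →
      cfc (fun t : ℝ => t ^ (1 : ℝ)) T = T := fun hT => by
    simp_rw [Real.rpow_one]
    exact cfc_id' ℝ _ hT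
  have hzero : ∀ {T : H →L[ℝ] H}, IsSelfAdjoint T →
      cfc (fun t : ℝ => t ^ (0 : ℝ)) T = 1 := fun hT => by
    simp_rw [Real.rpow_zero]
    exact cfc_const_one ℝ _ hT
  set P := cfc (fun t : ℝ => t ^ (-(1 / 2) : ℝ)) A with hP
  set Q := cfc (fun t : ℝ => t ^ (-1 : ℝ)) B with hQ
  have hPsa : IsSelfAdjoint P := cfc_predicate _ A
  have hBQ : B * Q = 1 := by
    have := cfc_rpow_add hBpos 1 (-1)
    rw [add_neg_cancel, hzero hB, hone hB] at this
    exact this.symm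
  have hPPA : P * (P * A) = 1 := by
    have h1 := cfc_rpow_add hApos (-(1 / 2)) (-(1 / 2) + 1)
    have h2 := cfc_rpow_add hApos (-(1 / 2)) 1
    rw [h2, hone hA, show (-(1 / 2) + (-(1 / 2) + 1) : ℝ) = 0 by ring, hzero hA] at h1
    exact h1.symm
  have hPD : hsNorm ((A - B) * P) = hsNorm (P * (A - B)) := by
    rw [← hsNorm_adjoint]
    congr 1
    change star ((A - B) * P) = _
    rw [star_mul, hPsa.star_eq, (hA.sub hB).star_eq]
  have hfact : A * Q - 1 = ((A - B) * P) * (P + P * (A - B) * Q) := by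
    have h1 : P * (P + P * (A - B) * Q) = Q := by
      calc P * (P + P * (A - B) * Q) = P * P + (P * (P * A)) * Q - P * P * (B * Q) := by
            noncomm_ring
        _ = Q := by rw [hPPA, hBQ]; noncomm_ring
    rw [mul_assoc, h1, sub_mul, hBQ]
  rw [hone hA, hfact]
  refine (hsNorm_mul_le_right ((A - B) * P) _).trans ?_
  rw [hPD]
  gcongr
  refine (enorm_add_le P (P * (A - B) * Q)).trans ?_
  rw [add_comm]
  refine add_le_add ?_ (hle hA hA1 _ (by norm_num))
  calc ‖P * (A - B) * Q‖ₑ ≤ hsNorm (P * (A - B) * Q) := enorm_le_hsNorm _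
    _ ≤ hsNorm (P * (A - B)) * ‖Q‖ₑ := hsNorm_mul_le_right _ _
    _ ≤ hsNorm (P * (A - B)) * 1 := by gcongr; exact hle hB hB1 _ (by norm_num)
    _ = _ := mul_one _

end RealFunctionalCalculus

/-! ### Nondecreasing sublinear functions -/

namespace KernelLearning

section Sublinear

variable {φ : ℝ → ℝ}

theorem pos_of_monotoneOn_of_antitoneOn_div (hnn : ∀ t, 0 ≤ t → 0 ≤ φ t)
    (hmono : MonotoneOn φ (Set.Ici 0)) (hanti : AntitoneOn (fun t => φ t / t) (Set.Ioi 0))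
    (hne : ∃ t, 0 ≤ t ∧ φ t ≠ 0) {t : ℝ} (ht : 0 < t) : 0 < φ t := by
  obtain ⟨s, hs, hφs⟩ := hne
  have hpos : 0 < φ s := lt_of_le_of_ne (hnn s hs) hφs.symm
  rcases le_total s t with h | h
  · exact hpos.trans_le (hmono hs ht.le h)
  · have hs' : 0 < s := ht.trans_le h
    have h2 : φ s / s ≤ φ t / t := hanti ht hs' h
    have h3 : 0 < φ t / t := (div_pos hpos hs').trans_le h2
    exact (div_pos_iff_of_pos_right ht).mp h3

/-- The quotient `φ a / φ b` lies between `1` and `a / b`: monotonicity compares it with `1`, and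
sublinearity compares it with `a / b`. -/
theorem abs_div_sub_one_le_of_antitoneOn_div (hpos : ∀ t, 0 < t → 0 < φ t)
    (hmono : MonotoneOn φ (Set.Ici 0)) (hanti : AntitoneOn (fun t => φ t / t) (Set.Ioi 0))
    (a b : ℝ) (ha : 0 < a) (hb : 0 < b) : |φ a / φ b - 1| ≤ |a / b - 1| := by
  have hφb := hpos b hb
  rcases le_total a b with h | h
  · have h1 : φ b / b ≤ φ a / a := hanti ha hb h
    have h2 : a / b ≤ φ a / φ b := by
      rw [div_le_div_iff₀ hb ha] at h1
      rw [div_le_div_iff₀ hb hφb]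
      linarith
    have h3 : φ a / φ b ≤ 1 := (div_le_one hφb).mpr (hmono ha.le hb.le h)
    rw [abs_of_nonpos (by linarith), abs_of_nonpos (by linarith)]
    linarith
  · have h1 : φ a / a ≤ φ b / b := hanti hb ha h
    have h2 : φ a / φ b ≤ a / b := by
      rw [div_le_div_iff₀ ha hb] at h1
      rw [div_le_div_iff₀ hφb hb]
      linarith
    have h3 : 1 ≤ φ a / φ b := (one_le_div hφb).mpr (hmono hb.le ha.le h)
    rw [abs_of_nonneg (by linarith), abs_of_nonneg (by linarith)]
    linarith

theorem continuousOn_of_abs_div_sub_one_le (hpos : ∀ t, 0 < t → 0 < φ t)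
    (hφ : ∀ a b, 0 < a → 0 < b → |φ a / φ b - 1| ≤ |a / b - 1|) :
    ContinuousOn φ (Set.Ioi 0) := by
  intro b hb
  have hb' : (0 : ℝ) < b := hb
  refine ContinuousAt.continuousWithinAt ?_
  rw [ContinuousAt, tendsto_iff_norm_sub_tendsto_zero]
  have hlim : Filter.Tendsto (fun a => φ b * |a / b - 1|) (nhds b) (nhds 0) := by
    have : Continuous fun a => φ b * |a / b - 1| := by fun_prop
    have h := this.tendsto b
    rwa [div_self hb'.ne', sub_self, abs_zero, mul_zero] at h
  refine tendsto_of_tendsto_of_tendsto_of_le_of_le' tendsto_const_nhds hlim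
    (Filter.Eventually.of_forall fun _ => norm_nonneg _) ?_
  filter_upwards [lt_mem_nhds hb'] with a ha
  have h1 : φ a - φ b = φ b * (φ a / φ b - 1) := by
    have := (hpos b hb').ne'
    field_simp
  rw [h1, norm_mul, Real.norm_of_nonneg (hpos b hb').le, Real.norm_eq_abs]
  exact mul_le_mul_of_nonneg_left (hφ a b ha hb') (hpos b hb').le

end Sublinear

/-! ### The second moment operators are positive and Hilbert–Schmidt -/

section

open MeasureTheory HilbertSchmidt
open scoped ENNReal

variable {H X : Type*} [NormedAddCommGroup H] [InnerProductSpace ℝ H] [CompleteSpace H]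
  [RKHS ℝ H X ℝ]

/-- Parseval's identity for `K_x`, since `b i x = ⟪b i, K_x⟫` and `‖K_x‖² = K(x, x)`. -/
theorem tsum_enorm_apply_sq {ι : Type*} (b : HilbertBasis ι ℝ H) (x : X) :
    ∑' i, ‖b i x‖ₑ ^ 2 = ENNReal.ofReal (kernel H x x) := by
  have h1 : ‖RKHS.kerFun H x (1 : ℝ)‖ₑ ^ 2 = ENNReal.ofReal (kernel H x x) := by
    have := RKHS.kernel_inner H x x (1 : ℝ) (1 : ℝ)
    rw [real_inner_self_eq_norm_sq] at this
    rw [← ofReal_norm, ← ENNReal.ofReal_pow (norm_nonneg _), ← this]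
    simp [kernel]
  rw [← h1, ← tsum_enorm_inner_sq b]
  refine tsum_congr fun i => ?_
  rw [RKHS.inner_kerFun]
  simp

theorem hsNorm_empiricalSecondMoment_ne_top {n : ℕ} (x : Fin n → X) :
    hsNorm (empiricalSecondMoment H x) ≠ ⊤ := by
  obtain ⟨w, b, -⟩ := exists_hilbertBasis ℝ H
  refine hsNorm_comp_ne_top b _ ?_
  have h : ∀ f : H, ‖sampling H x f‖ₑ ^ 2 = ∑ i, ‖f (x i)‖ₑ ^ 2 := fun f => by
    rw [← ofReal_norm, ← ENNReal.ofReal_pow (norm_nonneg _), EuclideanSpace.norm_sq_eq,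
      ENNReal.ofReal_sum_of_nonneg fun i _ => by positivity]
    refine Finset.sum_congr rfl fun i _ => ?_
    rw [ENNReal.ofReal_pow (norm_nonneg _), ofReal_norm]
    rfl
  simp_rw [h]
  rw [Summable.tsum_finsetSum fun _ _ => ENNReal.summable]
  simp_rw [tsum_enorm_apply_sq]
  exact ENNReal.sum_ne_top.mpr fun _ _ => ENNReal.ofReal_ne_top

theorem inner_empiricalSecondMoment_apply {n : ℕ} (x : Fin n → X) (f g : H) :
    inner ℝ (empiricalSecondMoment H x f) g = (n : ℝ)⁻¹ * ∑ i, f (x i) * g (x i) := by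
  rw [empiricalSecondMoment_apply, inner_smul_left, sum_inner, conj_trivial]
  congr 1
  refine Finset.sum_congr rfl fun i _ => ?_
  rw [inner_smul_left, RKHS.kerFun_inner]
  simp

theorem isPositive_empiricalSecondMoment {n : ℕ} (x : Fin n → X) :
    (empiricalSecondMoment H x).IsPositive := by
  refine (ContinuousLinearMap.isPositive_iff' _).mpr ⟨?_, fun f => ?_⟩
  · rw [ContinuousLinearMap.isSelfAdjoint_iff_isSymmetric]
    intro f g
    change inner ℝ (empiricalSecondMoment H x f) g = inner ℝ f (empiricalSecondMoment H x g)
    rw [real_inner_comm (empiricalSecondMoment H x g) f]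
    simp_rw [inner_empiricalSecondMoment_apply, mul_comm]
  · rw [inner_empiricalSecondMoment_apply]
    exact mul_nonneg (by positivity) (Finset.sum_nonneg fun i _ => mul_self_nonneg _)

variable [MeasurableSpace X]

/-- The inclusion `H → L²(ρ)` is Hilbert–Schmidt: for a Hilbert basis `b`, the sum of the
`‖b i‖²` in `L²(ρ)` is `∫ K(x, x) dρ(x)`, which is at most `sup K(x, x)`. -/
theorem hsNorm_secondMoment_ne_top (hK : IsBoundedMeasurableKernel H) (ρX : Measure X)
    [IsProbabilityMeasure ρX] : hsNorm (secondMoment hK ρX) ≠ ⊤ := by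
  obtain ⟨w, b, -⟩ := exists_hilbertBasis ℝ H
  refine hsNorm_comp_ne_top b _ ?_
  have h : ∀ f : H, ‖inclusion hK ρX f‖ₑ ^ 2 = ∫⁻ t, ‖f t‖ₑ ^ 2 ∂ρX := fun f => by
    have h1 : ‖inclusion hK ρX f‖ₑ = eLpNorm (f : X → ℝ) 2 ρX := by
      rw [Lp.enorm_def]
      exact eLpNorm_congr_ae (hK.memLp ρX f).coeFn_toLp
    rw [h1, eLpNorm_eq_lintegral_rpow_enorm_toReal two_ne_zero ENNReal.ofNat_ne_top,
      ← ENNReal.rpow_natCast, ← ENNReal.rpow_mul]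
    norm_num
  simp_rw [h]
  refine ne_top_of_le_ne_top (b := ENNReal.ofReal (⨆ y, kernel H y y)) ENNReal.ofReal_ne_top ?_
  -- Finite partial sums suffice, so sum and integral may be exchanged without countability.
  rw [ENNReal.tsum_eq_iSup_sum]
  refine iSup_le fun s => ?_
  rw [← lintegral_finsetSum _ fun i _ => ((hK.measurable_coe (b i)).enorm.pow_const 2)]
  calc ∫⁻ t, ∑ i ∈ s, ‖b i t‖ₑ ^ 2 ∂ρX ≤ ∫⁻ _, ENNReal.ofReal (⨆ y, kernel H y y) ∂ρX := by
        refine lintegral_mono fun t => ?_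
        refine (ENNReal.sum_le_tsum s).trans ?_
        rw [tsum_enorm_apply_sq b t]
        exact ENNReal.ofReal_le_ofReal (le_ciSup hK.bounded t)
    _ = ENNReal.ofReal (⨆ y, kernel H y y) := by simp

theorem isPositive_secondMoment (hK : IsBoundedMeasurableKernel H) (ρX : Measure X)
    [IsProbabilityMeasure ρX] : (secondMoment hK ρX).IsPositive :=
  ContinuousLinearMap.isPositive_adjoint_comp_self _

end

/-! ### Bounds for a pair of positive Hilbert–Schmidt operators -/

section

open HilbertSchmidt RealFunctionalCalculus

universe u

variable {H : Type*} [NormedAddCommGroup H] [InnerProductSpace ℝ H] [CompleteSpace H]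

theorem isSelfAdjoint_one_add {T : H →L[ℝ] H} (hT : T.IsPositive) : IsSelfAdjoint (1 + T) :=
  (IsSelfAdjoint.one _).add hT.isSelfAdjoint

theorem one_le_of_mem_spectrum_one_add {T : H →L[ℝ] H} (hT : T.IsPositive) {t : ℝ}
    (ht : t ∈ spectrum ℝ (1 + T)) : 1 ≤ t := by
  refine spectrum_ge_of_forall_le_inner (fun v => ?_) ht
  rw [add_apply, one_apply_eq_self, inner_add_left, real_inner_self_eq_norm_sq]
  linarith [hT.inner_nonneg_left v]

theorem exists_hilbertBasis_eigenvectors_one_add {H : Type u} [NormedAddCommGroup H]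
    [InnerProductSpace ℝ H] [CompleteSpace H] {T : H →L[ℝ] H} (hT : T.IsPositive)
    (hTs : hsNorm T ≠ ⊤) :
    ∃ (ι : Type u) (b : HilbertBasis ι ℝ H) (a : ι → ℝ), ∀ i, (1 + T) (b i) = a i • b i := by
  -- `1 + T` is not compact in general, but it has the eigenvectors of `T`.
  obtain ⟨ι, b, a, h⟩ := exists_hilbertBasis_eigenvectors hT.isSelfAdjoint
    (isCompactOperator_of_hsNorm_ne_top hTs)
  refine ⟨ι, b, fun i => 1 + a i, fun i => ?_⟩
  rw [add_apply, one_apply_eq_self, h, add_smul, one_smul]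

theorem hsNorm_smul_ne_top {T : H →L[ℝ] H} (hT : hsNorm T ≠ ⊤) (c : ℝ) : hsNorm (c • T) ≠ ⊤ := by
  rw [← smul_one_mul]
  exact ne_top_of_le_ne_top (ENNReal.mul_ne_top (by simp) hT) (hsNorm_mul_le_left _ _)

theorem psi_ne_top {S S' : H →L[ℝ] H} (hS : hsNorm S ≠ ⊤) (hS' : hsNorm S' ≠ ⊤) :
    psi S S' ≠ ⊤ :=
  ne_top_of_le_ne_top (ENNReal.mul_ne_top (by simp) (hsNorm_sub_ne_top hS hS'))
    (hsNorm_mul_le_left _ _)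

theorem hsNorm_one_add_mul_inv_sub_one_le {S S' : H →L[ℝ] H} (hS : S.IsPositive)
    (hS' : S'.IsPositive) :
    hsNorm (cfc (fun t : ℝ => t ^ (1 : ℝ)) (1 + S) * cfc (fun t : ℝ => t ^ (-1 : ℝ)) (1 + S') - 1)
      ≤ psi S S' * (psi S S' + 1) := by
  have h := hsNorm_mul_cfc_inv_sub_one_le (isSelfAdjoint_one_add hS) (isSelfAdjoint_one_add hS')
    (fun t => one_le_of_mem_spectrum_one_add hS) (fun t => one_le_of_mem_spectrum_one_add hS')
  rwa [add_sub_add_left_eq_sub] at h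

/-- `1 + p (p + 1) ≤ (p + 1) ^ 2`, together with the bound of the operator norm by the
Hilbert–Schmidt norm. -/
theorem norm_le_of_hsNorm_sub_one_le {T : H →L[ℝ] H} {p : ENNReal} (hp : p ≠ ⊤)
    (h : hsNorm (T - 1) ≤ p * (p + 1)) : ‖T‖ ≤ (p.toReal + 1) ^ 2 := by
  have h1 : ‖T - 1‖ ≤ p.toReal * (p.toReal + 1) := by
    have h2 := (enorm_le_hsNorm _).trans h
    rw [← ofReal_norm, ENNReal.ofReal_le_iff_le_toReal
      (ENNReal.mul_ne_top hp (ENNReal.add_ne_top.mpr ⟨hp, ENNReal.one_ne_top⟩)),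
      ENNReal.toReal_mul, ENNReal.toReal_add hp ENNReal.one_ne_top, ENNReal.toReal_one] at h2
    exact h2
  have h3 : ‖(1 : H →L[ℝ] H)‖ ≤ 1 := ContinuousLinearMap.norm_id_le
  have h4 : ‖T‖ ≤ ‖T - 1‖ + ‖(1 : H →L[ℝ] H)‖ := by
    have := norm_add_le (T - 1) 1
    rwa [sub_add_cancel] at this
  nlinarith [ENNReal.toReal_nonneg (a := p)]

theorem norm_one_add_rpow_mul_rpow_neg_le {S S' : H →L[ℝ] H} (hS : S.IsPositive)
    (hS' : S'.IsPositive) (hp : psi S S' ≠ ⊤) {r : ℝ} (hr0 : 0 ≤ r) (hr1 : r ≤ 1) :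
    ‖cfc (fun t : ℝ => t ^ r) (1 + S) * cfc (fun t : ℝ => t ^ (-r)) (1 + S')‖ ≤
      ((psi S S').toReal + 1) ^ (2 * r) := by
  have hpos : 0 < (psi S S').toReal + 1 := by positivity
  have h := norm_cfc_rpow_mul_le (isSelfAdjoint_one_add hS) (isSelfAdjoint_one_add hS')
    (fun t ht => one_pos.trans_le (one_le_of_mem_spectrum_one_add hS ht))
    (fun t ht => one_pos.trans_le (one_le_of_mem_spectrum_one_add hS' ht)) (pow_pos hpos 2)
    (norm_le_of_hsNorm_sub_one_le hp (hsNorm_one_add_mul_inv_sub_one_le hS hS')) hr0 hr1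
  rwa [← Real.rpow_natCast, ← Real.rpow_mul hpos.le, Nat.cast_ofNat] at h

theorem isUnit_cfc_one_add_and_norm_mul_inverse_le {S S' : H →L[ℝ] H} (hS : S.IsPositive)
    (hS' : S'.IsPositive) (hSs : hsNorm S ≠ ⊤) (hSs' : hsNorm S' ≠ ⊤) {φ : ℝ → ℝ}
    (hnn : ∀ t, 0 ≤ t → 0 ≤ φ t) (hmono : MonotoneOn φ (Set.Ici 0))
    (hanti : AntitoneOn (fun t => φ t / t) (Set.Ioi 0)) (hne : ∃ t, 0 ≤ t ∧ φ t ≠ 0) :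
    IsUnit (cfc φ (1 + S')) ∧
      ‖cfc φ (1 + S) * Ring.inverse (cfc φ (1 + S'))‖ ≤ ((psi S S').toReal + 1) ^ 2 := by
  have hpos : ∀ t, 0 < t → 0 < φ t := fun t =>
    pos_of_monotoneOn_of_antitoneOn_div hnn hmono hanti hne
  have hφ := abs_div_sub_one_le_of_antitoneOn_div hpos hmono hanti
  have hc := continuousOn_of_abs_div_sub_one_le hpos hφ
  have hA : ∀ t ∈ spectrum ℝ (1 + S), 0 < t := fun t ht =>
    one_pos.trans_le (one_le_of_mem_spectrum_one_add hS ht)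
  have hB : ∀ t ∈ spectrum ℝ (1 + S'), 0 < t := fun t ht =>
    one_pos.trans_le (one_le_of_mem_spectrum_one_add hS' ht)
  have hBsa := isSelfAdjoint_one_add hS'
  have hmul : cfc φ (1 + S') * cfc (fun t => (φ t)⁻¹) (1 + S') = 1 := by
    rw [← cfc_mul φ (fun t => (φ t)⁻¹) (1 + S') (hc.mono hB)
      ((hc.mono hB).inv₀ fun t ht => (hpos t (hB t ht)).ne')]
    exact (cfc_congr fun t ht => mul_inv_cancel₀ (hpos t (hB t ht)).ne').trans
      (cfc_const_one ℝ (1 + S'))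
  have hunit : IsUnit (cfc φ (1 + S')) :=
    ⟨⟨_, _, hmul, (cfc_commute_cfc (fun t => (φ t)⁻¹) φ (1 + S')).eq.trans hmul⟩, rfl⟩
  have hinv : Ring.inverse (cfc φ (1 + S')) = cfc (fun t => (φ t)⁻¹) (1 + S') := by
    rw [← Ring.inverse_mul_cancel_left _ (cfc (fun t => (φ t)⁻¹) (1 + S')) hunit, hmul, mul_one]
  refine ⟨hunit, ?_⟩
  rw [hinv]
  obtain ⟨ι, e, α, he⟩ := exists_hilbertBasis_eigenvectors_one_add hS hSs
  obtain ⟨κ, d, β, hd⟩ := exists_hilbertBasis_eigenvectors_one_add hS' hSs'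
  exact norm_le_of_hsNorm_sub_one_le (psi_ne_top hSs hSs')
    ((hsNorm_cfc_mul_cfc_inv_sub_one_le (isSelfAdjoint_one_add hS) hBsa hA hB e he d hd
      hpos hc hφ).trans (hsNorm_one_add_mul_inv_sub_one_le hS hS'))

end

end KernelLearning

open KernelLearning in
theorem mainTheorem5 {X H : Type*} [MeasurableSpace X]
    [NormedAddCommGroup H] [InnerProductSpace ℝ H] [CompleteSpace H]
    [TopologicalSpace.SeparableSpace H] [RKHS ℝ H X ℝ]
    (hK : IsBoundedMeasurableKernel H)
    (ρX : MeasureTheory.Measure X) [MeasureTheory.IsProbabilityMeasure ρX]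
    (n : ℕ) (hn : 0 < n) (x : Fin n → X) (lam : ℝ) (hlam : 0 < lam)
    (S Sx : H →L[ℝ] H) (hS : S = lam⁻¹ • secondMoment hK ρX)
    (hSx : Sx = lam⁻¹ • empiricalSecondMoment H x) :
    psi S Sx ≠ ⊤ ∧
    (∀ φ : ℝ → ℝ,
      (∀ t, 0 ≤ t → 0 ≤ φ t) →
      MonotoneOn φ (Set.Ici 0) →
      AntitoneOn (fun t => φ t / t) (Set.Ioi 0) →
      (∃ t, 0 ≤ t ∧ φ t ≠ 0) →
        IsUnit (cfc φ (1 + Sx)) ∧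
        ‖cfc φ (1 + S) * Ring.inverse (cfc φ (1 + Sx))‖ ≤ ((psi S Sx).toReal + 1) ^ 2) ∧
    (∀ r : ℝ, 0 ≤ r → r ≤ 1 →
      ‖cfc (fun t : ℝ => t ^ r) (1 + S) * cfc (fun t : ℝ => t ^ (-r)) (1 + Sx)‖
        ≤ ((psi S Sx).toReal + 1) ^ (2 * r)) := by
  have hlam' : 0 ≤ lam⁻¹ := (inv_pos.mpr hlam).le
  have hSp : S.IsPositive := hS ▸ (isPositive_secondMoment hK ρX).smul_of_nonneg hlam'
  have hSxp : Sx.IsPositive := hSx ▸ (isPositive_empiricalSecondMoment x).smul_of_nonneg hlam'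
  have hSs : HilbertSchmidt.hsNorm S ≠ ⊤ :=
    hS ▸ hsNorm_smul_ne_top (hsNorm_secondMoment_ne_top hK ρX) _
  have hSxs : HilbertSchmidt.hsNorm Sx ≠ ⊤ :=
    hSx ▸ hsNorm_smul_ne_top (hsNorm_empiricalSecondMoment_ne_top x) _
  exact ⟨psi_ne_top hSs hSxs,
    fun φ => isUnit_cfc_one_add_and_norm_mul_inverse_le hSp hSxp hSs hSxs,
    fun r => norm_one_add_rpow_mul_rpow_neg_le hSp hSxp (psi_ne_top hSs hSxs)⟩
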